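/- Let $p,q$ be coprime integers with $1\le q<p$. On the torus $T=\mathbb R^2/\mathbb Z^2$ let $v$ be the closed curve $t\mapsto(t,0)$ and $w$ the closed curve $t\mapsto(qt,pt)$; $(T;v,w)$ is the standard genus-one Heegaard diagram of the lens space $L(p,q)$. Its Heegaard graph $G$ is the graph $v\cup w$ embedded in $T$, whose vertices are the points of $v\cap w$ and whose edges are the arcs into which these points divide $v$ and $w$. Let $G_m$ be the medial graph of $G$, with the faces containing vertices of $G$ coloured black and the others white. A Penrose state $s$ chooses, at each vertex of $G_m$, either the white smoothing (the four incident half-edges are merged in two pairs, each bounding a common white face, so that the resulting strands run along the two sides of the edge of $G$) or the crossing (opposite half-edges are merged). Let $cr(s)$ be the number of crossings of $s$ and $c(s)$ the number of closed curves that result, and let $$P(G;\lambda)=\sum_{s}(-1)^{cr(s)}\lambda^{c(s)}$$ be the Penrose polynomial, the sum running over all Penrose states of $G_m$. Then $P(G;\lambda)$ is monic, and $\deg P(G;\lambda)>p$ if and only if $q\equiv\pm1\pmod p$, that is, $q=1$ or $q=p-1$ (equivalently, $L(p,q)$ is homeomorphic to $L(p,1)$). -/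

import Mathlib

noncomputable section

/-! ### Cellularly embedded graphs and the Penrose polynomial -/

/-- A finite graph without isolated vertices, cellularly embedded in a closed oriented surface,
given by its rotation system. `D` is the set of darts (half-edges, each pointing away from the
vertex it is attached to); `rot` sends a dart to the next one counterclockwise around its vertex,
and `opp` exchanges the two darts of an edge. The vertices, edges and faces are the orbits of `rot`,
of `opp`, and of their composite. -/
structure EmbeddedGraph (D : Type) where
  finite_darts : Finite D
  rot : Equiv.Perm D
  opp : Equiv.Perm D
  opp_opp : ∀ d, opp (opp d) = d
  opp_ne : ∀ d, opp d ≠ d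

/-- The two sides of a dart, as seen when looking away from its vertex. -/
inductive Side
  | left
  | right

/-- The opposite side. -/
def Side.flip : Side → Side
  | .left => .right
  | .right => .left

/-- The vertex states that may occur in a Penrose state. -/
inductive Smoothing
  | white
  | crossing

instance : Finite Smoothing :=
  Finite.of_injective (fun s : Smoothing => match s with | .white => true | .crossing => false)
    (by intro a b; cases a <;> cases b <;> simp)

namespace EmbeddedGraph

variable {D : Type} (G : EmbeddedGraph D)

/-- Two darts belong to the same edge. -/
def edgeSetoid : Setoid D where
  r d e := e = d ∨ e = G.opp d
  iseqv :=
    { refl := fun _ => Or.inl rfl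
      symm := by
        rintro d e (rfl | rfl)
        · exact Or.inl rfl
        · exact Or.inr (G.opp_opp d).symm
      trans := by
        rintro d e f (rfl | rfl) (rfl | rfl)
        · exact Or.inl rfl
        · exact Or.inr rfl
        · exact Or.inr rfl
        · exact Or.inl (G.opp_opp d) }

/-- The edges of `G`, which are also the vertices of the medial graph `G_m`. -/
def Edge : Type := Quotient G.edgeSetoid

/-- The edge of a dart. -/
def edgeOf (d : D) : G.Edge := Quotient.mk G.edgeSetoid d

/-- The half-edges of the medial graph `G_m`. At the medial vertex on the edge `{d, opp d}` there
are four of them, in cyclic order `(d, left)`, `(d, right)`, `(opp d, left)`, `(opp d, right)`: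
the half-edge `(d, side)` leaves the midpoint of the edge towards the vertex of `d`, on the given
side of `d`. The medial face between `(d, left)` and `(d, right)` contains the vertex of `d` and is
black; the one between `(d, right)` and `(opp d, left)` lies in a face of `G` and is white. -/
abbrev MedialHalfEdge (_ : EmbeddedGraph D) : Type := D × Side

/-- The other end of an edge of the medial graph: for each dart `d`, an edge of `G_m` runs through
the corner of `G` between `d` and `rot d`. -/
def medialOpp : G.MedialHalfEdge → G.MedialHalfEdge
  | (d, .left) => (G.rot d, .right)
  | (d, .right) => (G.rot.symm d, .left)

/-- A Penrose state: a white smoothing or a crossing at each vertex of the medial graph. -/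
abbrev PenroseState : Type := G.Edge → Smoothing

/-- How a Penrose state merges the half-edges at each vertex of `G_m`. The white smoothing merges
`(d, right)` with `(opp d, left)`, two half-edges that bound a common white face; the crossing
merges the opposite half-edges `(d, left)` and `(opp d, left)`. -/
def merge (s : G.PenroseState) (x : G.MedialHalfEdge) : G.MedialHalfEdge :=
  match s (G.edgeOf x.1) with
  | .white => (G.opp x.1, x.2.flip)
  | .crossing => (G.opp x.1, x.2)

/-- The closed curves of a state, i.e. the boundary components of the ribbon graph it determines:
half-edges of `G_m` modulo the relation generated by running along an edge of `G_m` and by passing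
through a vertex as the state prescribes. -/
def StateCurve (s : G.PenroseState) : Type :=
  Quot (fun x y : G.MedialHalfEdge => y = G.medialOpp x ∨ y = G.merge s x)

/-- `c(s)`, the number of boundary components of a state. -/
def numCurves (s : G.PenroseState) : ℕ := Nat.card (G.StateCurve s)

/-- `cr(s)`, the number of crossings of a state. -/
def numCrossings (s : G.PenroseState) : ℕ := Nat.card {e : G.Edge // s e = Smoothing.crossing}

theorem finite_penroseState : Finite G.PenroseState := by
  have := G.finite_darts
  have : Finite G.Edge := Quotient.finite _
  infer_instance

/-- The Penrose polynomial `P(G; X) = ∑ₛ (-1) ^ cr(s) X ^ c(s)`. -/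
def penrosePolynomial : Polynomial ℤ :=
  haveI := G.finite_penroseState
  letI := Fintype.ofFinite G.PenroseState
  ∑ s : G.PenroseState, (-1) ^ G.numCrossings s * Polynomial.X ^ G.numCurves s

end EmbeddedGraph

/-! ### The standard genus one Heegaard diagram of the lens space `L(p,q)` -/

/-- The torus `ℝ² / ℤ²`. -/
abbrev Torus : Type := UnitAddCircle × UnitAddCircle

/-- The covering projection of the plane onto the torus. -/
def toTorus (u : ℝ × ℝ) : Torus := ((u.1 : UnitAddCircle), (u.2 : UnitAddCircle))

/-- The meridian `v` of the solid torus `V` in which the first circle factor bounds a disk. -/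
def meridianCurve : Set Torus := Set.range fun t : ℝ => toTorus (t, 0)

/-- The curve `w`, winding `p` times along the longitude and `q` times along the meridian of `V`;
the second solid torus is attached so that `w` bounds a disk in it. -/
def lensCurve (p q : ℕ) : Set Torus := Set.range fun t : ℝ => toTorus (q * t, p * t)

/-- The vertices of the Heegaard graph: the intersection points of `v` and `w`. -/
def heegaardVertices (p q : ℕ) : Set Torus := meridianCurve ∩ lensCurve p q

/-- The four directions in which the graph `v ∪ w` leaves an intersection point. -/
inductive Heading
  | vForward
  | wForward
  | vBackward
  | wBackward

namespace Heading

/-- The velocity vector of a heading. For `p > 0` the four vectors are listed counterclockwise. -/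
def velocity (p q : ℕ) : Heading → ℝ × ℝ
  | vForward => (1, 0)
  | wForward => (q, p)
  | vBackward => (-1, 0)
  | wBackward => (-q, -p)

/-- The next heading counterclockwise. -/
def rotate : Equiv.Perm Heading where
  toFun
    | vForward => wForward
    | wForward => vBackward
    | vBackward => wBackward
    | wBackward => vForward
  invFun
    | vForward => wBackward
    | wForward => vForward
    | vBackward => wForward
    | wBackward => vBackward
  left_inv h := by cases h <;> rfl
  right_inv h := by cases h <;> rfl

/-- The reversed heading. -/
def reverse : Heading → Heading
  | vForward => vBackward
  | wForward => wBackward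
  | vBackward => vForward
  | wBackward => wForward

instance : Finite Heading :=
  Finite.of_injective
    (fun h : Heading => match h with
      | vForward => (0 : Fin 4) | wForward => 1 | vBackward => 2 | wBackward => 3)
    (by intro a b; cases a <;> cases b <;> simp)

end Heading

/-- The point reached from `x` after moving for time `t` along the curve with heading `h`. -/
def travel (p q : ℕ) (x : Torus) (h : Heading) (t : ℝ) : Torus :=
  x + toTorus (t • h.velocity p q)

/-- The first positive time at which the curve leaving `x` with heading `h` meets a vertex. -/
def firstHit (p q : ℕ) (x : Torus) (h : Heading) : ℝ :=
  sInf {t : ℝ | 0 < t ∧ travel p q x h t ∈ heegaardVertices p q}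

theorem toTorus_eq_iff (a b a' b' : ℝ) :
    toTorus (a, b) = toTorus (a', b') ↔ (∃ m : ℤ, a = a' + m) ∧ ∃ n : ℤ, b = b' + n := by
  have key : ∀ a b : ℝ, ((a : UnitAddCircle) = b) ↔ ∃ m : ℤ, a = b + m := by
    intro a b
    rw [← sub_eq_zero, ← AddCircle.coe_sub, AddCircle.coe_eq_zero_iff]
    refine exists_congr fun m => ?_
    rw [zsmul_one]
    constructor <;> intro h <;> linarith
  simp only [toTorus, Prod.mk.injEq, key]

theorem toTorus_surjective (x : Torus) : ∃ a b : ℝ, x = toTorus (a, b) := by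
  obtain ⟨x₁, x₂⟩ := x
  obtain ⟨a, rfl⟩ := QuotientAddGroup.mk_surjective x₁
  obtain ⟨b, rfl⟩ := QuotientAddGroup.mk_surjective x₂
  exact ⟨a, b, rfl⟩

theorem toTorus_mem_heegaardVertices {p q : ℕ} (hp : 0 < p) (hpq : p.Coprime q) (a b : ℝ) :
    toTorus (a, b) ∈ heegaardVertices p q ↔ (∃ k : ℤ, p * a = k) ∧ ∃ m : ℤ, b = m := by
  have hp' : (p : ℝ) ≠ 0 := by exact_mod_cast hp.ne'
  constructor
  · rintro ⟨⟨t, ht⟩, s, hs⟩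
    obtain ⟨-, n, hn⟩ := (toTorus_eq_iff _ _ _ _).1 ht
    obtain ⟨⟨k, hk⟩, l, hl⟩ := (toTorus_eq_iff _ _ _ _).1 hs
    refine ⟨⟨q * (l - n) - p * k, ?_⟩, -n, ?_⟩
    · push_cast
      linear_combination (-(p : ℝ)) * hk + q * hl - q * hn
    · push_cast
      linarith
  · rintro ⟨⟨k, hk⟩, m, rfl⟩
    refine ⟨⟨a, (toTorus_eq_iff _ _ _ _).2 ⟨⟨0, by simp⟩, -m, by simp⟩⟩, ?_⟩
    have hb := Int.gcd_eq_gcd_ab p q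
    rw [Int.gcd_natCast_natCast, hpq] at hb
    have hb' : (1 : ℝ) = p * (Int.gcdA p q : ℤ) + q * (Int.gcdB p q : ℤ) := by exact_mod_cast hb
    refine ⟨k * (Int.gcdB p q : ℤ) / p, (toTorus_eq_iff _ _ _ _).2
      ⟨⟨-(k * Int.gcdA p q), ?_⟩, k * Int.gcdB p q - m, ?_⟩⟩
    · field_simp
      push_cast
      linear_combination (-(k : ℝ)) * hb' - hk
    · field_simp
      push_cast
      ring

theorem travel_mem_heegaardVertices {p q : ℕ} (hp : 0 < p) (hpq : p.Coprime q) {x : Torus}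
    (hx : x ∈ heegaardVertices p q) (h : Heading) (t : ℝ) :
    travel p q x h t ∈ heegaardVertices p q ↔ ∃ k : ℤ, p * t = k := by
  obtain ⟨a, b, rfl⟩ := toTorus_surjective x
  obtain ⟨⟨k, hk⟩, m, rfl⟩ := (toTorus_mem_heegaardVertices hp hpq a b).1 hx
  have hadd : travel p q (toTorus (a, (m : ℝ))) h t =
      toTorus (a + t * (h.velocity p q).1, m + t * (h.velocity p q).2) := by
    simp [travel, toTorus]
  rw [hadd, toTorus_mem_heegaardVertices hp hpq]
  cases h <;> simp only [Heading.velocity]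
  · constructor
    · rintro ⟨⟨l, hl⟩, -⟩
      exact ⟨l - k, by push_cast; linarith⟩
    · rintro ⟨l, hl⟩
      exact ⟨⟨k + l, by push_cast; linarith⟩, m, by ring⟩
  · constructor
    · rintro ⟨-, l, hl⟩
      exact ⟨l - m, by push_cast; linarith⟩
    · rintro ⟨l, hl⟩
      exact ⟨⟨k + q * l, by push_cast; linear_combination hk + q * hl⟩, m + l, by
        push_cast; linarith⟩
  · constructor
    · rintro ⟨⟨l, hl⟩, -⟩
      exact ⟨k - l, by push_cast; linarith⟩
    · rintro ⟨l, hl⟩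
      exact ⟨⟨k - l, by push_cast; linarith⟩, m, by ring⟩
  · constructor
    · rintro ⟨-, l, hl⟩
      exact ⟨m - l, by push_cast; linarith⟩
    · rintro ⟨l, hl⟩
      exact ⟨⟨k - q * l, by push_cast; linear_combination hk - q * hl⟩, m - l, by
        push_cast; linarith⟩

theorem isLeast_firstHit {p q : ℕ} (hp : 0 < p) (hpq : p.Coprime q) {x : Torus}
    (hx : x ∈ heegaardVertices p q) (h : Heading) :
    IsLeast {t : ℝ | 0 < t ∧ travel p q x h t ∈ heegaardVertices p q} (1 / p) := by
  have hp' : (0 : ℝ) < p := by exact_mod_cast hp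
  refine ⟨⟨by positivity, ?_⟩, ?_⟩
  · exact (travel_mem_heegaardVertices hp hpq hx h _).2 ⟨1, by field_simp; simp⟩
  · rintro t ⟨ht, hmem⟩
    obtain ⟨k, hk⟩ := (travel_mem_heegaardVertices hp hpq hx h t).1 hmem
    have hk0 : (0 : ℝ) < k := hk ▸ mul_pos hp' ht
    have hk1 : (1 : ℝ) ≤ k := by exact_mod_cast (by exact_mod_cast hk0 : (0 : ℤ) < k)
    rw [div_le_iff₀ hp']
    linarith

theorem firstHit_eq {p q : ℕ} (hp : 0 < p) (hpq : p.Coprime q) {x : Torus}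
    (hx : x ∈ heegaardVertices p q) (h : Heading) : firstHit p q x h = 1 / p :=
  (isLeast_firstHit hp hpq hx h).csInf_eq

theorem finite_heegaardVertices {p q : ℕ} (hp : 0 < p) (hpq : p.Coprime q) :
    (heegaardVertices p q).Finite := by
  have hp' : (p : ℝ) ≠ 0 := by exact_mod_cast hp.ne'
  refine ((Set.finite_Ico (0 : ℤ) p).image fun k : ℤ => toTorus ((k : ℝ) / p, 0)).subset ?_
  intro x hx
  obtain ⟨a, b, rfl⟩ := toTorus_surjective x
  obtain ⟨⟨k, hk⟩, m, rfl⟩ := (toTorus_mem_heegaardVertices hp hpq a b).1 hx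
  have hpz : (0 : ℤ) < p := by exact_mod_cast hp
  refine ⟨k % p, ⟨Int.emod_nonneg _ hpz.ne', Int.emod_lt_of_pos _ hpz⟩,
    (toTorus_eq_iff _ _ _ _).2 ⟨⟨-(k / p), ?_⟩, -m, by simp⟩⟩
  have hdiv : ((k % p : ℤ) : ℝ) + p * ((k / p : ℤ) : ℝ) = k := by
    exact_mod_cast Int.emod_add_mul_ediv k p
  field_simp
  push_cast
  linear_combination hdiv - hk

/-- Follow an edge of the Heegaard graph from one end to the other: the dart that leaves the vertex
`x` with heading `h` runs along its curve up to the first vertex it meets; the dart of the same edge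
at that vertex points back. -/
def traverse {p q : ℕ} (hp : 0 < p) (hpq : p.Coprime q)
    (d : heegaardVertices p q × Heading) : heegaardVertices p q × Heading :=
  (⟨travel p q d.1 d.2 (firstHit p q d.1 d.2), by
    rw [firstHit_eq hp hpq d.1.2]
    exact (isLeast_firstHit hp hpq d.1.2 d.2).1.2⟩, d.2.reverse)

theorem traverse_traverse {p q : ℕ} (hp : 0 < p) (hpq : p.Coprime q)
    (d : heegaardVertices p q × Heading) : traverse hp hpq (traverse hp hpq d) = d := by
  obtain ⟨⟨x, hx⟩, h⟩ := d
  refine Prod.ext (Subtype.ext ?_) (by cases h <;> rfl)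
  change travel p q (travel p q x h (firstHit p q x h)) h.reverse
    (firstHit p q (travel p q x h (firstHit p q x h)) h.reverse) = x
  have hmem := (isLeast_firstHit hp hpq hx h).1.2
  rw [firstHit_eq hp hpq hx, firstHit_eq hp hpq hmem, travel, travel, add_assoc]
  refine add_eq_left.2 ?_
  cases h <;> simp [toTorus, Heading.velocity, Heading.reverse]

/-- The Heegaard graph `v ∪ w` of the standard diagram of `L(p,q)`, embedded in the Heegaard torus.
Its vertices are the points of `v ∩ w`, and its edges are the arcs into which these points
divide `v` and `w`. -/
def heegaardGraph (p q : ℕ) (hp : 0 < p) (hpq : p.Coprime q) :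
    EmbeddedGraph (heegaardVertices p q × Heading) where
  finite_darts := by
    have := (finite_heegaardVertices hp hpq).to_subtype
    infer_instance
  rot := (Equiv.refl _).prodCongr Heading.rotate
  opp := Function.Involutive.toPerm (traverse hp hpq) (traverse_traverse hp hpq)
  opp_opp := traverse_traverse hp hpq
  opp_ne := by
    rintro ⟨x, h⟩ hd
    have h2 : h.reverse = h := congrArg Prod.snd hd
    cases h <;> cases h2

end

noncomputable section

/-! In each case one state has strictly more curves than all others and an even number of crossings,
so it alone gives the leading term (`penrosePolynomial_of_unique_max`). The vertices are the points
`(k/p, 0)`; edges of `v` translate `k` by `1` and edges of `w` by `q`, so everything can be computed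
in `ZMod p` (`penrosePolynomial_heegaardGraph`). A state curve runs through the `4p` corners,
alternately along edges of `v` and of `w`, by two involutions `V` and `W`.

If `q ≠ ±1` there are no parallel edges, so `x`, `V x`, `W x`, `W (V x)` are four distinct corners
of one curve. Hence there are at most `p` curves, and equality forces `V` and `W` to commute
(`numCurves_le_and_steps_comm`). Comparing vertices in `ZMod p`, commutation rules out every
crossing (`eq_whiteState_of_steps_comm`). The leading state consists of the `p` faces, and the
degree is `p`.

If `q = 1` the edges form `p` parallel pairs. The all-crossing state has a two-corner curve inside
each pair and at least one more curve. A state with a wholly white pair has at most `p` curves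
(`numCurves_le_of_white_pair`); any other state identifies curves of the all-crossing one
(`numCurves_lt_of_no_white_pair`). The case `q = p - 1` is the mirror image
(`penrosePolynomial_toroidalGraph_neg`). -/

theorem Side.flip_flip (a : Side) : a.flip.flip = a := by cases a <;> rfl

/-! ### Leading term and isomorphism invariance of the Penrose polynomial. -/

namespace EmbeddedGraph

variable {D D' : Type}

/-- A state with strictly more curves than every other one, and with an even number of crossings,
contributes the leading term of the Penrose polynomial. -/
theorem penrosePolynomial_of_unique_max (G : EmbeddedGraph D) (s₀ : G.PenroseState)
    (heven : Even (G.numCrossings s₀)) (hmax : ∀ s, s ≠ s₀ → G.numCurves s < G.numCurves s₀) :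
    G.penrosePolynomial.Monic ∧ G.penrosePolynomial.natDegree = G.numCurves s₀ := by
  classical
  have := G.finite_penroseState
  let _ := Fintype.ofFinite G.PenroseState
  have key : G.penrosePolynomial = Polynomial.X ^ G.numCurves s₀ +
      ∑ s ∈ Finset.univ.erase s₀,
        (-1) ^ G.numCrossings s * Polynomial.X ^ G.numCurves s := by
    rw [penrosePolynomial, ← Finset.add_sum_erase _ _ (Finset.mem_univ s₀), heven.neg_one_pow,
      one_mul]
  have hdeg : (∑ s ∈ Finset.univ.erase s₀,
      ((-1) ^ G.numCrossings s * Polynomial.X ^ G.numCurves s : Polynomial ℤ)).degree <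
        (G.numCurves s₀ : WithBot ℕ) := by
    refine lt_of_le_of_lt (Polynomial.degree_sum_le _ _) ?_
    rw [Finset.sup_lt_iff (WithBot.bot_lt_coe _)]
    intro s hs
    have h := hmax s (Finset.ne_of_mem_erase hs)
    have : ((-1) ^ G.numCrossings s * Polynomial.X ^ G.numCurves s : Polynomial ℤ) =
        Polynomial.C ((-1) ^ G.numCrossings s) * Polynomial.X ^ G.numCurves s := by simp
    rw [this]
    refine lt_of_le_of_lt (Polynomial.degree_C_mul_X_pow_le _ _) ?_
    exact_mod_cast h
  rw [key]
  refine ⟨Polynomial.monic_X_pow_add hdeg, ?_⟩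
  refine Polynomial.natDegree_eq_of_degree_eq_some ?_
  rw [Polynomial.degree_add_eq_left_of_degree_lt] <;> rw [Polynomial.degree_X_pow]
  exact hdeg

/-- The Penrose polynomial is an invariant of embedded graphs up to isomorphism. Taking
`ψ = Side.flip` covers isomorphisms that reverse the orientation. -/
theorem penrosePolynomial_congr (G : EmbeddedGraph D) (G' : EmbeddedGraph D') (φ : D ≃ D')
    (ψ : Side ≃ Side) (hflip : ∀ a, ψ a.flip = (ψ a).flip)
    (hopp : ∀ d, φ (G.opp d) = G'.opp (φ d))
    (hmed : ∀ x, φ.prodCongr ψ (G.medialOpp x) = G'.medialOpp (φ.prodCongr ψ x)) :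
    G.penrosePolynomial = G'.penrosePolynomial := by
  have := G.finite_penroseState
  have := G'.finite_penroseState
  let _ := Fintype.ofFinite G.PenroseState
  let _ := Fintype.ofFinite G'.PenroseState
  let ε : G.Edge ≃ G'.Edge := Quotient.congr φ (by
    intro d e
    change (e = d ∨ e = G.opp d) ↔ (φ e = φ d ∨ φ e = G'.opp (φ d))
    rw [← hopp, φ.injective.eq_iff, φ.injective.eq_iff])
  have hε : ∀ d, ε (G.edgeOf d) = G'.edgeOf (φ d) := fun _ => rfl
  unfold penrosePolynomial
  refine Fintype.sum_equiv (ε.arrowCongr (Equiv.refl Smoothing)) _ _ fun s => ?_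
  set s' : G'.PenroseState := ε.arrowCongr (Equiv.refl Smoothing) s with hs'
  have hs : ∀ e, s' (ε e) = s e := fun e => by simp [hs', Equiv.arrowCongr]
  have hcr : G.numCrossings s = G'.numCrossings s' :=
    Nat.card_congr (ε.subtypeEquiv fun e => by rw [hs])
  have hmerge : ∀ x, φ.prodCongr ψ (G.merge s x) = G'.merge s' (φ.prodCongr ψ x) := by
    rintro ⟨d, a⟩
    have h := hs (G.edgeOf d)
    rw [hε] at h
    simp only [merge, Equiv.prodCongr_apply, Prod.map_apply, h]
    cases s (G.edgeOf d) <;> simp [hflip, hopp]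
  have hcurves : G.numCurves s = G'.numCurves s' :=
    Nat.card_congr (Quot.congr (φ.prodCongr ψ) fun x y => by
      rw [← hmed, ← hmerge, (φ.prodCongr ψ).injective.eq_iff, (φ.prodCongr ψ).injective.eq_iff])
  rw [hcr, hcurves]

end EmbeddedGraph

/-! ### The combinatorial model over `ZMod p`. -/

namespace Heading

/-- The displacement along the vertices `0, 1, …, p - 1` of `v`, read modulo `p`, when an edge
of the Heegaard graph is followed. -/
def step {p : ℕ} (q : ZMod p) : Heading → ZMod p
  | vForward => 1
  | wForward => q
  | vBackward => -1
  | wBackward => -q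

theorem step_reverse {p : ℕ} (q : ZMod p) (h : Heading) : h.reverse.step q = -h.step q := by
  cases h <;> simp [reverse, step]

end Heading

theorem step_involutive {p : ℕ} (q : ZMod p) :
    Function.Involutive fun d : ZMod p × Heading => (d.1 + d.2.step q, d.2.reverse) := by
  rintro ⟨k, h⟩
  refine Prod.ext ?_ (by cases h <;> rfl)
  simp [Heading.step_reverse]

/-- The quadrangulation of the torus with vertex set `ℤ/p` in which the vertex `k` is joined
to `k ± 1` and to `k ± q`. -/
def toroidalGraph (p : ℕ) [NeZero p] (q : ZMod p) : EmbeddedGraph (ZMod p × Heading) where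
  finite_darts := inferInstance
  rot := (Equiv.refl _).prodCongr Heading.rotate
  opp := (step_involutive q).toPerm
  opp_opp := step_involutive q
  opp_ne := by
    rintro ⟨k, h⟩ hd
    have h2 : h.reverse = h := congrArg Prod.snd hd
    cases h <;> cases h2

/-- The involution exchanging the two sides. -/
def Side.flipEquiv : Side ≃ Side :=
  Function.Involutive.toPerm Side.flip Side.flip_flip

/-- The reflection `k ↦ -k` on darts: it reverses the direction of `v` and keeps that of `w`. -/
def Heading.reflect : Heading → Heading
  | vForward => vBackward
  | wForward => wForward
  | vBackward => vForward
  | wBackward => wBackward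

theorem Heading.reflect_reflect (h : Heading) : h.reflect.reflect = h := by cases h <;> rfl

/-- The reflection `k ↦ -k` reverses `v` and keeps the direction of `w`. It reverses the orientation
of the torus, so the two sides of each dart are exchanged as well. -/
theorem penrosePolynomial_toroidalGraph_neg (p : ℕ) [NeZero p] (q : ZMod p) :
    (toroidalGraph p q).penrosePolynomial = (toroidalGraph p (-q)).penrosePolynomial := by
  refine EmbeddedGraph.penrosePolynomial_congr _ _
    ((Equiv.neg (ZMod p)).prodCongr
      (Function.Involutive.toPerm Heading.reflect Heading.reflect_reflect))
    Side.flipEquiv (fun a => rfl) ?_ ?_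
  · rintro ⟨k, h⟩
    refine Prod.ext ?_ (by cases h <;> rfl)
    change -(k + h.step q) = -k + h.reflect.step (-q)
    cases h <;> simp [Heading.step, Heading.reflect, add_comm]
  · rintro ⟨⟨k, h⟩, a⟩
    cases h <;> cases a <;> rfl

/-- The homomorphism `k ↦ (k/p, 0)` onto the vertices of the Heegaard graph. -/
def vertexHom (p : ℕ) [NeZero p] : ZMod p →+ Torus :=
  ZMod.lift p ⟨zmultiplesHom Torus (toTorus (1 / p, 0)), by
    have hp : (p : ℝ) ≠ 0 := by exact_mod_cast NeZero.ne p
    have h1 : (p : ℤ) • toTorus (1 / p, 0) = toTorus (1, 0) := by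
      simp only [toTorus, Prod.smul_mk, ← AddCircle.coe_zsmul, zsmul_eq_mul, Int.cast_natCast,
        mul_zero, mul_one_div_cancel hp]
    rw [zmultiplesHom_apply, h1]
    exact ((toTorus_eq_iff _ _ 0 0).2 ⟨⟨1, by simp⟩, 0, by simp⟩)⟩

theorem vertexHom_intCast (p : ℕ) [NeZero p] (k : ℤ) :
    vertexHom p (k : ZMod p) = toTorus (k / p, 0) := by
  rw [vertexHom, ZMod.lift_coe]
  simp only [zmultiplesHom_apply, toTorus, Prod.smul_mk, ← AddCircle.coe_zsmul, zsmul_eq_mul,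
    mul_zero, mul_one_div]

theorem vertexHom_injective (p : ℕ) [NeZero p] : Function.Injective (vertexHom p) := by
  have hp : (p : ℝ) ≠ 0 := by exact_mod_cast NeZero.ne p
  intro a b hab
  obtain ⟨k, rfl⟩ := ZMod.intCast_surjective a
  obtain ⟨l, rfl⟩ := ZMod.intCast_surjective b
  rw [vertexHom_intCast, vertexHom_intCast, toTorus_eq_iff] at hab
  obtain ⟨⟨m, hm⟩, -⟩ := hab
  field_simp at hm
  have : k = l + p * m := by exact_mod_cast hm
  simp [this]

theorem range_vertexHom (p : ℕ) [NeZero p] {q : ℕ} (hpq : p.Coprime q) :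
    Set.range (vertexHom p) = heegaardVertices p q := by
  have hp0 : 0 < p := NeZero.pos p
  have hp : (p : ℝ) ≠ 0 := by exact_mod_cast NeZero.ne p
  ext x
  constructor
  · rintro ⟨a, rfl⟩
    obtain ⟨k, rfl⟩ := ZMod.intCast_surjective a
    rw [vertexHom_intCast, toTorus_mem_heegaardVertices hp0 hpq]
    exact ⟨⟨k, by field_simp⟩, 0, by simp⟩
  · intro hx
    obtain ⟨a, b, rfl⟩ := toTorus_surjective x
    obtain ⟨⟨k, hk⟩, m, rfl⟩ := (toTorus_mem_heegaardVertices hp0 hpq a b).1 hx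
    refine ⟨k, ?_⟩
    rw [vertexHom_intCast, toTorus_eq_iff]
    exact ⟨⟨0, by field_simp; simp [← hk]⟩, -m, by simp⟩

/-- Every edge is traversed in time `1/p`. Along `w` this moves by `(q/p, 1)`, and the vertical
displacement is a full period; what remains is translation by `q` in `ZMod p`. -/
theorem toTorus_smul_velocity (p q : ℕ) [NeZero p] (h : Heading) :
    toTorus ((1 / p : ℝ) • h.velocity p q) = vertexHom p (h.step (q : ZMod p)) := by
  have hp : (p : ℝ) ≠ 0 := by exact_mod_cast NeZero.ne p
  have hcast : h.step (q : ZMod p) = ((match h with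
      | .vForward => 1 | .wForward => q | .vBackward => -1 | .wBackward => -q : ℤ) : ZMod p) := by
    cases h <;> simp [Heading.step]
  rw [hcast, vertexHom_intCast]
  cases h <;> simp only [Heading.velocity, Prod.smul_mk, smul_eq_mul, toTorus_eq_iff]
  · exact ⟨⟨0, by simp⟩, 0, by simp⟩
  · exact ⟨⟨0, by simp; ring⟩, 1, by field_simp; simp⟩
  · exact ⟨⟨0, by simp; ring⟩, 0, by simp⟩
  · exact ⟨⟨0, by simp; ring⟩, -1, by field_simp; simp⟩

/-- The Heegaard graph is isomorphic to its combinatorial model. -/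
theorem penrosePolynomial_heegaardGraph (p q : ℕ) [NeZero p] (hp : 0 < p) (hpq : p.Coprime q) :
    (heegaardGraph p q hp hpq).penrosePolynomial =
      (toroidalGraph p (q : ZMod p)).penrosePolynomial := by
  let ν : ZMod p ≃ heegaardVertices p q :=
    (Equiv.ofInjective _ (vertexHom_injective p)).trans (Equiv.setCongr (range_vertexHom p hpq))
  have hν : ∀ k, (ν k : Torus) = vertexHom p k := fun _ => rfl
  refine (EmbeddedGraph.penrosePolynomial_congr _ _ (ν.prodCongr (Equiv.refl Heading))
    (Equiv.refl Side) (fun _ => rfl) ?_ ?_).symm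
  · rintro ⟨k, h⟩
    refine Prod.ext (Subtype.ext ?_) rfl
    change vertexHom p (k + h.step (q : ZMod p)) =
      travel p q (ν k) h (firstHit p q (ν k) h)
    rw [firstHit_eq hp hpq (ν k).2, travel, toTorus_smul_velocity, map_add, hν]
  · rintro ⟨⟨k, h⟩, a⟩
    cases a <;> rfl

/-! ### Curves as orbits of corners

A corner is named by the dart that bounds it on the clockwise side, so that the corners at a vertex
are, in counterclockwise order, `vForward` (north-east), `wForward` (north-west),
`vBackward` (south-west) and `wBackward` (south-east). -/

section Corners

variable {p : ℕ}

/-- Follow the boundary of a ribbon graph along an edge of `v`, from corner to corner. -/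
def vStep (a : ZMod p → Smoothing) : ZMod p × Heading → ZMod p × Heading
  | (k, .vForward) => match a k with
    | .white => (k + 1, .wForward)
    | .crossing => (k + 1, .vBackward)
  | (k, .wForward) => match a (k - 1) with
    | .white => (k - 1, .vForward)
    | .crossing => (k - 1, .wBackward)
  | (k, .vBackward) => match a (k - 1) with
    | .white => (k - 1, .wBackward)
    | .crossing => (k - 1, .vForward)
  | (k, .wBackward) => match a k with
    | .white => (k + 1, .vBackward)
    | .crossing => (k + 1, .wForward)

/-- Follow the boundary of a ribbon graph along an edge of `w`, from corner to corner. -/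
def wStep (q : ZMod p) (b : ZMod p → Smoothing) : ZMod p × Heading → ZMod p × Heading
  | (k, .vForward) => match b k with
    | .white => (k + q, .wBackward)
    | .crossing => (k + q, .vBackward)
  | (k, .wForward) => match b k with
    | .white => (k + q, .vBackward)
    | .crossing => (k + q, .wBackward)
  | (k, .vBackward) => match b (k - q) with
    | .white => (k - q, .wForward)
    | .crossing => (k - q, .vForward)
  | (k, .wBackward) => match b (k - q) with
    | .white => (k - q, .vForward)
    | .crossing => (k - q, .wForward)

theorem vStep_vStep (a : ZMod p → Smoothing) (x : ZMod p × Heading) :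
    vStep a (vStep a x) = x := by
  obtain ⟨k, h⟩ := x
  rcases h₁ : a k <;> rcases h₂ : a (k - 1) <;> cases h <;> simp [vStep, h₁, h₂]

theorem wStep_wStep (q : ZMod p) (b : ZMod p → Smoothing) (x : ZMod p × Heading) :
    wStep q b (wStep q b x) = x := by
  obtain ⟨k, h⟩ := x
  rcases h₁ : b k <;> rcases h₂ : b (k - q) <;> cases h <;> simp [wStep, h₁, h₂]

/-- The smoothing affects only the corner of arrival, never the vertex; the count without parallel
edges needs no more than this. -/
theorem vStep_fst (a : ZMod p → Smoothing) (x : ZMod p × Heading) :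
    (vStep a x).1 = x.1 + 1 ∨ (vStep a x).1 = x.1 - 1 := by
  obtain ⟨k, h⟩ := x
  cases h <;> simp only [vStep] <;> split <;> simp

theorem wStep_fst (q : ZMod p) (b : ZMod p → Smoothing) (x : ZMod p × Heading) :
    (wStep q b x).1 = x.1 + q ∨ (wStep q b x).1 = x.1 - q := by
  obtain ⟨k, h⟩ := x
  cases h <;> simp only [wStep] <;> split <;> simp

/-- The corner through which the medial edge at a medial half-edge runs. -/
def cornerOf : (ZMod p × Heading) × Side → ZMod p × Heading
  | (d, .left) => d
  | (d, .right) => (d.1, Heading.rotate.symm d.2)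

/-- Whether a heading is along `v`. -/
def Heading.IsAlongV : Heading → Prop
  | vForward | vBackward => True
  | wForward | wBackward => False

/-- A corner lies between a dart of `v` and a dart of `w`. Its medial edge therefore has one end at
each, which is why curves alternate between the two kinds of step. -/
theorem exists_cornerOf_isAlongV (x : ZMod p × Heading) :
    ∃ y : (ZMod p × Heading) × Side, cornerOf y = x ∧ y.1.2.IsAlongV := by
  obtain ⟨k, h⟩ := x
  cases h
  · exact ⟨((k, .vForward), .left), rfl, trivial⟩
  · exact ⟨((k, .vBackward), .right), rfl, trivial⟩
  · exact ⟨((k, .vBackward), .left), rfl, trivial⟩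
  · exact ⟨((k, .vForward), .right), rfl, trivial⟩

theorem exists_cornerOf_not_isAlongV (x : ZMod p × Heading) :
    ∃ y : (ZMod p × Heading) × Side, cornerOf y = x ∧ ¬ y.1.2.IsAlongV := by
  obtain ⟨k, h⟩ := x
  cases h
  · exact ⟨((k, .wForward), .right), rfl, id⟩
  · exact ⟨((k, .wForward), .left), rfl, id⟩
  · exact ⟨((k, .wBackward), .right), rfl, id⟩
  · exact ⟨((k, .wBackward), .left), rfl, id⟩

variable [NeZero p] {q : ZMod p}

/-- The smoothings of a state along `v`, indexed by the initial vertex of an edge. -/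
def vState (s : (toroidalGraph p q).PenroseState) (k : ZMod p) : Smoothing :=
  s ((toroidalGraph p q).edgeOf (k, .vForward))

/-- The smoothings of a state along `w`, indexed by the initial vertex of an edge. -/
def wState (s : (toroidalGraph p q).PenroseState) (k : ZMod p) : Smoothing :=
  s ((toroidalGraph p q).edgeOf (k, .wForward))

theorem edgeOf_vBackward (k : ZMod p) :
    (toroidalGraph p q).edgeOf (k, .vBackward) =
      (toroidalGraph p q).edgeOf (k - 1, .vForward) :=
  Quotient.sound (Or.inr (by
    change _ = (k + -1, Heading.vForward)
    rw [sub_eq_add_neg]))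

theorem edgeOf_wBackward (k : ZMod p) :
    (toroidalGraph p q).edgeOf (k, .wBackward) =
      (toroidalGraph p q).edgeOf (k - q, .wForward) :=
  Quotient.sound (Or.inr (by
    change _ = (k + -q, Heading.wForward)
    rw [sub_eq_add_neg]))

theorem state_ext {s t : (toroidalGraph p q).PenroseState} (hv : ∀ k, vState s k = vState t k)
    (hw : ∀ k, wState s k = wState t k) : s = t := by
  funext e
  induction e using Quotient.ind with
  | _ d =>
    obtain ⟨k, h⟩ := d
    change s ((toroidalGraph p q).edgeOf (k, h)) = t ((toroidalGraph p q).edgeOf (k, h))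
    cases h
    · exact hv k
    · exact hw k
    · rw [edgeOf_vBackward]
      exact hv _
    · rw [edgeOf_wBackward]
      exact hw _

theorem cornerOf_medialOpp (x : (ZMod p × Heading) × Side) :
    cornerOf ((toroidalGraph p q).medialOpp x) = cornerOf x := by
  obtain ⟨⟨k, h⟩, a⟩ := x
  cases h <;> cases a <;> rfl

theorem cornerOf_merge_of_isAlongV (s : (toroidalGraph p q).PenroseState)
    (x : (ZMod p × Heading) × Side) (hx : x.1.2.IsAlongV) :
    cornerOf ((toroidalGraph p q).merge s x) = vStep (vState s) (cornerOf x) := by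
  obtain ⟨⟨k, h⟩, a⟩ := x
  have e1 : (toroidalGraph p q).opp (k, .vForward) = (k + 1, .vBackward) := rfl
  have e2 : (toroidalGraph p q).opp (k, .vBackward) = (k - 1, .vForward) := by
    rw [sub_eq_add_neg]; rfl
  cases h <;> first | exact hx.elim | skip
  · rcases hs : s ((toroidalGraph p q).edgeOf (k, .vForward)) <;> cases a <;>
      simp [EmbeddedGraph.merge, hs, e1, Side.flip, cornerOf, vStep, vState, Heading.rotate]
  · have he : (toroidalGraph p q).edgeOf (k, .vBackward) = _ := edgeOf_vBackward k
    rcases hs : s ((toroidalGraph p q).edgeOf (k - 1, .vForward)) <;> cases a <;>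
      simp [EmbeddedGraph.merge, he, hs, e2, Side.flip, cornerOf, vStep, vState, Heading.rotate]

theorem cornerOf_merge_of_not_isAlongV (s : (toroidalGraph p q).PenroseState)
    (x : (ZMod p × Heading) × Side) (hx : ¬ x.1.2.IsAlongV) :
    cornerOf ((toroidalGraph p q).merge s x) = wStep q (wState s) (cornerOf x) := by
  obtain ⟨⟨k, h⟩, a⟩ := x
  have e1 : (toroidalGraph p q).opp (k, .wForward) = (k + q, .wBackward) := rfl
  have e2 : (toroidalGraph p q).opp (k, .wBackward) = (k - q, .wForward) := by
    rw [sub_eq_add_neg]; rfl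
  cases h <;> first | exact (hx trivial).elim | skip
  · rcases hs : s ((toroidalGraph p q).edgeOf (k, .wForward)) <;> cases a <;>
      simp [EmbeddedGraph.merge, hs, e1, Side.flip, cornerOf, wStep, wState, Heading.rotate]
  · have he : (toroidalGraph p q).edgeOf (k, .wBackward) = _ := edgeOf_wBackward k
    rcases hs : s ((toroidalGraph p q).edgeOf (k - q, .wForward)) <;> cases a <;>
      simp [EmbeddedGraph.merge, he, hs, e2, Side.flip, cornerOf, wStep, wState, Heading.rotate]

/-- The closed curve of a state through a corner. -/
def curveAt (s : (toroidalGraph p q).PenroseState) (x : ZMod p × Heading) :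
    (toroidalGraph p q).StateCurve s :=
  Quot.mk _ (x, Side.left)

theorem mk_eq_curveAt (s : (toroidalGraph p q).PenroseState) (x : (ZMod p × Heading) × Side) :
    (Quot.mk _ x : (toroidalGraph p q).StateCurve s) = curveAt s (cornerOf x) := by
  obtain ⟨⟨k, h⟩, a⟩ := x
  cases a
  · rfl
  · exact Quot.sound (Or.inl rfl)

theorem curveAt_surjective (s : (toroidalGraph p q).PenroseState) :
    Function.Surjective (curveAt s) := by
  intro c
  induction c using Quot.ind with
  | _ x => exact ⟨_, (mk_eq_curveAt s x).symm⟩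

theorem curveAt_vStep (s : (toroidalGraph p q).PenroseState) (x : ZMod p × Heading) :
    curveAt s (vStep (vState s) x) = curveAt s x := by
  obtain ⟨y, rfl, hy⟩ := exists_cornerOf_isAlongV x
  rw [← cornerOf_merge_of_isAlongV s y hy, ← mk_eq_curveAt, ← mk_eq_curveAt]
  refine (Quot.sound ?_).symm
  exact Or.inr rfl

theorem curveAt_wStep (s : (toroidalGraph p q).PenroseState) (x : ZMod p × Heading) :
    curveAt s (wStep q (wState s) x) = curveAt s x := by
  obtain ⟨y, rfl, hy⟩ := exists_cornerOf_not_isAlongV x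
  rw [← cornerOf_merge_of_not_isAlongV s y hy, ← mk_eq_curveAt, ← mk_eq_curveAt]
  refine (Quot.sound ?_).symm
  exact Or.inr rfl

/-- A function on corners that is constant along curves descends to the curves of a state. -/
theorem exists_curve_lift (s : (toroidalGraph p q).PenroseState) {α : Type*}
    (c : ZMod p × Heading → α) (hv : ∀ x, c (vStep (vState s) x) = c x)
    (hw : ∀ x, c (wStep q (wState s) x) = c x) :
    ∃ F : (toroidalGraph p q).StateCurve s → α, ∀ x, F (curveAt s x) = c x := by
  refine ⟨Quot.lift (fun x => c (cornerOf x)) ?_, fun x => rfl⟩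
  rintro x y (rfl | rfl)
  · simp only [cornerOf_medialOpp]
  · by_cases hx : x.1.2.IsAlongV
    · simp only [cornerOf_merge_of_isAlongV s x hx, hv]
    · simp only [cornerOf_merge_of_not_isAlongV s x hx, hw]

instance (s : (toroidalGraph p q).PenroseState) : Finite ((toroidalGraph p q).StateCurve s) :=
  Finite.of_surjective _ (curveAt_surjective s)

end Corners

/-! ### Counting by fibres, with the equality case. -/

theorem mul_card_le_of_le_card_fiber {α β : Type*} [Fintype α] [Fintype β] [DecidableEq β]
    (f : α → β) (n : ℕ) (h : ∀ b, n ≤ (Finset.univ.filter fun a => f a = b).card) :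
    n * Fintype.card β ≤ Fintype.card α := by
  have hsum := Finset.card_eq_sum_card_fiberwise (f := f) (s := Finset.univ) (t := Finset.univ)
    (fun _ _ => Finset.mem_coe.2 (Finset.mem_univ _))
  have hle := Finset.card_nsmul_le_sum Finset.univ _ n fun b _ => h b
  rw [← hsum, smul_eq_mul, Finset.card_univ, Finset.card_univ] at hle
  linarith [mul_comm n (Fintype.card β)]

theorem card_fiber_eq_of_card_le {α β : Type*} [Fintype α] [Fintype β] [DecidableEq β]
    (f : α → β) (n : ℕ) (h : ∀ b, n ≤ (Finset.univ.filter fun a => f a = b).card)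
    (hc : Fintype.card α ≤ n * Fintype.card β) (b : β) :
    (Finset.univ.filter fun a => f a = b).card = n := by
  have hsum := Finset.card_eq_sum_card_fiberwise (f := f) (s := Finset.univ) (t := Finset.univ)
    (fun _ _ => Finset.mem_coe.2 (Finset.mem_univ _))
  by_contra hb
  have hlt : ∑ _b : β, n < ∑ b, (Finset.univ.filter fun a => f a = b).card :=
    Finset.sum_lt_sum (fun b _ => h b) ⟨b, Finset.mem_univ b, lt_of_le_of_ne (h b) (Ne.symm hb)⟩
  rw [← hsum, Finset.sum_const, smul_eq_mul, Finset.card_univ, Finset.card_univ] at hlt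
  linarith [mul_comm n (Fintype.card β)]

namespace Heading

/-- The four headings, numbered counterclockwise. -/
def equivFin : Heading ≃ Fin 4 where
  toFun
    | vForward => 0
    | wForward => 1
    | vBackward => 2
    | wBackward => 3
  invFun := ![vForward, wForward, vBackward, wBackward]
  left_inv h := by cases h <;> rfl
  right_inv i := by fin_cases i <;> rfl

end Heading

/-! ### No parallel edges: the faces form the leading state. -/

section Generic

variable {p : ℕ} {q : ZMod p}

/-- Without parallel edges, the two neighbours of a corner along its curve are distinct from it and
from each other. -/
theorem corner_neighbours_ne (h1 : (1 : ZMod p) ≠ 0) (hq0 : q ≠ 0) (hq1 : q ≠ 1) (hq2 : q ≠ -1)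
    (a b : ZMod p → Smoothing) (x : ZMod p × Heading) :
    vStep a x ≠ x ∧ wStep q b x ≠ x ∧ vStep a x ≠ wStep q b x := by
  have hv := vStep_fst a x
  have hw := wStep_fst q b x
  refine ⟨fun h => ?_, fun h => ?_, fun h => ?_⟩
  · rw [h] at hv
    rcases hv with hv | hv
    · exact h1 (left_eq_add.1 hv)
    · exact h1 (sub_eq_self.1 hv.symm)
  · rw [h] at hw
    rcases hw with hw | hw
    · exact hq0 (left_eq_add.1 hw)
    · exact hq0 (sub_eq_self.1 hw.symm)
  · rw [h] at hv
    rcases hv with hv | hv <;> rcases hw with hw | hw <;> rw [hw] at hv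
    · exact hq1 (add_left_cancel hv)
    · exact hq2 (by linear_combination -hv)
    · exact hq2 (by linear_combination hv)
    · exact hq1 (by linear_combination -hv)

variable [NeZero p]

/-- The state with white smoothings only; its curves bound the faces. -/
def whiteState (p : ℕ) [NeZero p] (q : ZMod p) : (toroidalGraph p q).PenroseState :=
  fun _ => .white

theorem numCrossings_whiteState : (toroidalGraph p q).numCrossings (whiteState p q) = 0 := by
  have : IsEmpty {e : (toroidalGraph p q).Edge // whiteState p q e = Smoothing.crossing} :=
    ⟨fun e => Smoothing.noConfusion e.2⟩
  exact Nat.card_of_isEmpty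

/-- The face in which a corner lies, named by its south-west vertex. -/
def faceOf (q : ZMod p) : ZMod p × Heading → ZMod p
  | (k, .vForward) => k
  | (k, .wForward) => k - 1
  | (k, .vBackward) => k - 1 - q
  | (k, .wBackward) => k - q

/-- With white smoothings both steps stay inside one face, so `faceOf` is constant on curves, and it
takes all `p` values on north-east corners. Only this bound is needed, since the reverse one holds
for every state when there are no parallel edges. -/
theorem le_numCurves_whiteState : p ≤ (toroidalGraph p q).numCurves (whiteState p q) := by
  obtain ⟨F, hF⟩ := exists_curve_lift (whiteState p q) (faceOf q)
    (by rintro ⟨k, h⟩; cases h <;> simp [vStep, vState, whiteState, faceOf])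
    (by rintro ⟨k, h⟩; cases h <;> simp [wStep, wState, whiteState, faceOf] <;> ring)
  have hsurj : Function.Surjective F := fun k => ⟨curveAt _ (k, .vForward), hF _⟩
  simpa [EmbeddedGraph.numCurves] using Nat.card_le_card_of_surjective F hsurj

-- The map from the `4p` corners to the curves has fibres of size at least four. If there are `p`
-- curves, every fibre is exactly `{x, V x, W x, W (V x)}`. It contains `V (W x)`, which can equal
-- none of the first three without contradicting `corner_neighbours_ne`.
open Classical in
theorem numCurves_le_and_steps_comm (h1 : (1 : ZMod p) ≠ 0) (hq0 : q ≠ 0) (hq1 : q ≠ 1)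
    (hq2 : q ≠ -1) (s : (toroidalGraph p q).PenroseState) :
    (toroidalGraph p q).numCurves s ≤ p ∧ (p ≤ (toroidalGraph p q).numCurves s → ∀ x,
      vStep (vState s) (wStep q (wState s) x) = wStep q (wState s) (vStep (vState s) x)) := by
  have := Fintype.ofFinite ((toroidalGraph p q).StateCurve s)
  have := Fintype.ofFinite (ZMod p × Heading)
  set V := vStep (vState s) with hV
  set W := wStep q (wState s) with hW
  have hVV : ∀ x, V (V x) = x := vStep_vStep _
  have hWW : ∀ x, W (W x) = x := wStep_wStep _ _
  have h4 : ∀ x, V x ≠ x ∧ W x ≠ x ∧ V x ≠ W x := corner_neighbours_ne h1 hq0 hq1 hq2 _ _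
  have hcV : ∀ x, curveAt s (V x) = curveAt s x := curveAt_vStep s
  have hcW : ∀ x, curveAt s (W x) = curveAt s x := curveAt_wStep s
  have hcard : ∀ x, ({x, V x, W x, W (V x)} : Finset (ZMod p × Heading)).card = 4 := by
    intro x
    obtain ⟨n1, n2, n3⟩ := h4 x
    have n4 : W (V x) ≠ x := fun h => n3 (by rw [← hWW (V x), h])
    have n5 : W (V x) ≠ V x := (h4 (V x)).2.1
    have n6 : W (V x) ≠ W x := fun h => n1 (by rw [← hWW (V x), h, hWW])
    rw [Finset.card_insert_of_notMem, Finset.card_insert_of_notMem, Finset.card_pair n6.symm]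
    · simp [n3, n5.symm]
    · simp [n1.symm, n2.symm, n4.symm]
  have hsub : ∀ x, ({x, V x, W x, W (V x)} : Finset (ZMod p × Heading)) ⊆
      Finset.univ.filter fun y => curveAt s y = curveAt s x := by
    intro x y hy
    simp only [Finset.mem_insert, Finset.mem_singleton] at hy
    rcases hy with rfl | rfl | rfl | rfl <;> simp [hcV, hcW]
  have hfib : ∀ c, 4 ≤ (Finset.univ.filter fun y => curveAt s y = c).card := by
    intro c
    obtain ⟨x, rfl⟩ := curveAt_surjective s c
    exact (hcard x).symm.le.trans (Finset.card_le_card (hsub x))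
  have hD : Fintype.card (ZMod p × Heading) = 4 * p := by
    rw [← Nat.card_eq_fintype_card, Nat.card_prod, Nat.card_zmod,
      Nat.card_congr Heading.equivFin, Nat.card_fin, mul_comm]
  have hC : (toroidalGraph p q).numCurves s = Fintype.card ((toroidalGraph p q).StateCurve s) :=
    Nat.card_eq_fintype_card
  refine ⟨?_, fun hp x => ?_⟩
  · have := mul_card_le_of_le_card_fiber _ _ hfib
    omega
  · have heq := card_fiber_eq_of_card_le _ _ hfib (by omega) (curveAt s x)
    have hset := Finset.eq_of_subset_of_card_le (hsub x) (by rw [heq, hcard])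
    have hmem : V (W x) ∈ ({x, V x, W x, W (V x)} : Finset (ZMod p × Heading)) := by
      rw [hset]
      simp [hcV, hcW]
    simp only [Finset.mem_insert, Finset.mem_singleton] at hmem
    rcases hmem with h | h | h | h
    · exact absurd (by rw [← hVV (W x), h]) (h4 x).2.2
    · exact absurd (by rw [← hVV (W x), h, hVV]) (h4 x).2.1
    · exact absurd h (h4 (W x)).1
    · exact h

/-- It suffices to compare the vertices reached by the two orders of steps. A crossing on an edge of
`v` reverses the `w`-direction of the following step; a crossing on an edge of `w` does the same
with the roles exchanged. -/
theorem eq_whiteState_of_steps_comm (h2 : (2 : ZMod p) ≠ 0) (h4 : (4 : ZMod p) ≠ 0)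
    (h2q : 2 * q ≠ 0) (s : (toroidalGraph p q).PenroseState)
    (hcomm : ∀ x, vStep (vState s) (wStep q (wState s) x) =
      wStep q (wState s) (vStep (vState s) x)) : s = whiteState p q := by
  have hv : ∀ k, vState s k = .white := by
    intro k
    rcases hs : vState s k
    · rfl
    exfalso
    -- The two corners at `k` on either side of the crossed edge are tested. The first gives `k + 1
    -- - q = k + q ± 1`, the second `k + 1 + q = k - q ± 1`. A plus sign in either yields `2q = 0`;
    -- two minus signs add up to `4 = 0`.
    have e1 := congrArg Prod.fst (hcomm (k, .vForward))
    have e2 := congrArg Prod.fst (hcomm (k, .wBackward))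
    have f1 := vStep_fst (vState s) (wStep q (wState s) (k, .vForward))
    have f2 := vStep_fst (vState s) (wStep q (wState s) (k, .wBackward))
    have g1 : (wStep q (wState s) (vStep (vState s) (k, .vForward))).1 = k + 1 - q := by
      simp only [vStep, hs, wStep]; split <;> rfl
    have g2 : (wStep q (wState s) (vStep (vState s) (k, .wBackward))).1 = k + 1 + q := by
      simp only [vStep, hs, wStep]; split <;> rfl
    have i1 : (wStep q (wState s) (k, .vForward)).1 = k + q := by
      simp only [wStep]; split <;> rfl
    have i2 : (wStep q (wState s) (k, .wBackward)).1 = k - q := by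
      simp only [wStep]; split <;> rfl
    rw [e1, g1, i1] at f1
    rw [e2, g2, i2] at f2
    rcases f1 with f1 | f1
    · exact h2q (by linear_combination -f1)
    rcases f2 with f2 | f2
    · exact h2q (by linear_combination f2)
    exact h4 (by linear_combination f1 + f2)
  refine state_ext hv fun k => ?_
  change wState s k = .white
  rcases hs : wState s k
  · rfl
  exfalso
  -- Now all of `v` is white. One order ends at `k + 1 + q`, while the crossing on `w` makes the
  -- other end at `k + q - 1`, so `2 = 0`.
  have e := congrArg Prod.fst (hcomm (k, .vForward))
  have g : (wStep q (wState s) (vStep (vState s) (k, .vForward))).1 = k + 1 + q := by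
    simp only [vStep, hv, wStep]; split <;> rfl
  rw [g] at e
  simp only [vStep, hv, wStep, hs] at e
  exact h2 (by linear_combination -e)

/-- If the quadrangulation has no parallel edges, its faces are the leading state. -/
theorem penrosePolynomial_toroidalGraph_of_ne (h2 : (2 : ZMod p) ≠ 0) (h4 : (4 : ZMod p) ≠ 0)
    (h2q : 2 * q ≠ 0) (hq1 : q ≠ 1) (hq2 : q ≠ -1) :
    (toroidalGraph p q).penrosePolynomial.Monic ∧
      (toroidalGraph p q).penrosePolynomial.natDegree = p := by
  have h1 : (1 : ZMod p) ≠ 0 := fun h => h2 (by linear_combination 2 * h)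
  have hq0 : q ≠ 0 := fun h => h2q (by rw [h, mul_zero])
  have key := numCurves_le_and_steps_comm h1 hq0 hq1 hq2
  have hw : (toroidalGraph p q).numCurves (whiteState p q) = p :=
    le_antisymm (key _).1 le_numCurves_whiteState
  obtain ⟨hm, hd⟩ := (toroidalGraph p q).penrosePolynomial_of_unique_max (whiteState p q)
    (by simp [numCrossings_whiteState]) fun s hs => by
      rw [hw]
      by_contra! hle
      exact hs (eq_whiteState_of_steps_comm h2 h4 h2q s ((key s).2 hle))
  exact ⟨hm, hd.trans hw⟩

end Generic

/-! ### Parallel edges, `q = 1`: the all-crossing state leads. -/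

section Parallel

variable {p : ℕ} [NeZero p]

/-- The state with crossings only. -/
def crossingState (p : ℕ) [NeZero p] (q : ZMod p) : (toroidalGraph p q).PenroseState :=
  fun _ => .crossing

/-- The edges are the edges of `v` and those of `w`, each named by its initial vertex. -/
def edgeEquiv (q : ZMod p) : (toroidalGraph p q).Edge ≃ ZMod p ⊕ ZMod p where
  toFun := Quotient.lift (fun d : ZMod p × Heading => match d with
      | (k, .vForward) => Sum.inl k
      | (k, .wForward) => Sum.inr k
      | (k, .vBackward) => Sum.inl (k - 1)
      | (k, .wBackward) => Sum.inr (k - q)) (by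
    rintro ⟨k, h⟩ d (rfl | rfl)
    · rfl
    · cases h <;>
        simp [toroidalGraph, Heading.step, Heading.reverse, sub_eq_add_neg])
  invFun := Sum.elim (fun k => (toroidalGraph p q).edgeOf (k, .vForward))
    (fun k => (toroidalGraph p q).edgeOf (k, .wForward))
  left_inv e := by
    induction e using Quotient.ind with
    | _ d =>
      obtain ⟨k, h⟩ := d
      cases h
      · rfl
      · rfl
      · exact (edgeOf_vBackward k).symm
      · exact (edgeOf_wBackward k).symm
  right_inv e := by rcases e with k | k <;> rfl

/-- There are `p` edges on each of the two curves, all of them crossed; the parity makes the leading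
coefficient `+1`. -/
theorem even_numCrossings_crossingState (q : ZMod p) :
    Even ((toroidalGraph p q).numCrossings (crossingState p q)) := by
  have h : (toroidalGraph p q).numCrossings (crossingState p q) = p + p := by
    have hall : ∀ e, crossingState p q e = Smoothing.crossing := fun _ => rfl
    rw [EmbeddedGraph.numCrossings,
      Nat.card_congr ((Equiv.subtypeUnivEquiv hall).trans (edgeEquiv q)), Nat.card_sum,
      Nat.card_zmod]
  exact ⟨p, h⟩

/-- For `q = 1`, a corner between two parallel edges is sent to the pair of edges, the others
to `none`. -/
def digonOf : ZMod p × Heading → Option (ZMod p)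
  | (k, .vForward) => some k
  | (_, .wForward) => none
  | (k, .vBackward) => some (k - 1)
  | (_, .wBackward) => none

/-- With crossings everywhere, both steps exchange the north-east corner at `k` with the south-west
corner at `k + 1`, and keep the two outer kinds of corner among themselves. -/
theorem exists_digon_lift :
    ∃ F : (toroidalGraph p 1).StateCurve (crossingState p 1) → Option (ZMod p),
      ∀ x, F (curveAt _ x) = digonOf x :=
  exists_curve_lift (crossingState p 1) digonOf
    (by rintro ⟨k, h⟩; cases h <;> simp [vStep, vState, crossingState, digonOf])
    (by rintro ⟨k, h⟩; cases h <;> simp [wStep, wState, crossingState, digonOf])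

/-- The value `none`, taken on the outer corners, supplies the curve beyond the `p` digons. How many
outer curves there are is irrelevant. -/
theorem lt_numCurves_crossingState :
    p < (toroidalGraph p 1).numCurves (crossingState p 1) := by
  obtain ⟨F, hF⟩ := exists_digon_lift (p := p)
  have hsurj : Function.Surjective F := by
    rintro (_ | k)
    · exact ⟨curveAt _ (0, .wForward), hF _⟩
    · exact ⟨curveAt _ (k, .vForward), hF _⟩
  have h := Nat.card_le_card_of_surjective F hsurj
  rwa [Finite.card_option, Nat.card_zmod] at h

variable (s : (toroidalGraph p 1).PenroseState)

theorem curveAt_of_vState_white {k : ZMod p} (h : vState s k = .white) :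
    curveAt s (k + 1, .wForward) = curveAt s (k, .vForward) ∧
      curveAt s (k + 1, .vBackward) = curveAt s (k, .wBackward) := by
  have h1 := curveAt_vStep s (k, .vForward)
  have h2 := curveAt_vStep s (k, .wBackward)
  simp only [vStep, h] at h1 h2
  exact ⟨h1, h2⟩

theorem curveAt_of_vState_crossing {k : ZMod p} (h : vState s k = .crossing) :
    curveAt s (k + 1, .vBackward) = curveAt s (k, .vForward) ∧
      curveAt s (k + 1, .wForward) = curveAt s (k, .wBackward) := by
  have h1 := curveAt_vStep s (k, .vForward)
  have h2 := curveAt_vStep s (k, .wBackward)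
  simp only [vStep, h] at h1 h2
  exact ⟨h1, h2⟩

theorem curveAt_of_wState_white {k : ZMod p} (h : wState s k = .white) :
    curveAt s (k + 1, .wBackward) = curveAt s (k, .vForward) ∧
      curveAt s (k + 1, .vBackward) = curveAt s (k, .wForward) := by
  have h1 := curveAt_wStep s (k, .vForward)
  have h2 := curveAt_wStep s (k, .wForward)
  simp only [wStep, h] at h1 h2
  exact ⟨h1, h2⟩

theorem curveAt_of_wState_crossing {k : ZMod p} (h : wState s k = .crossing) :
    curveAt s (k + 1, .vBackward) = curveAt s (k, .vForward) ∧
      curveAt s (k + 1, .wBackward) = curveAt s (k, .wForward) := by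
  have h1 := curveAt_wStep s (k, .vForward)
  have h2 := curveAt_wStep s (k, .wForward)
  simp only [wStep, h] at h1 h2
  exact ⟨h1, h2⟩

/-- Unless both edges of a parallel pair are smoothed, the strands on the outer sides of the pair
run through it, and those on the inner sides belong to one curve. -/
theorem curveAt_of_exists_crossing {k : ZMod p}
    (h : ¬ (vState s k = .white ∧ wState s k = .white)) :
    curveAt s (k + 1, .vBackward) = curveAt s (k, .vForward) ∧
      curveAt s (k + 1, .wForward) = curveAt s (k, .wBackward) ∧
      curveAt s (k + 1, .wBackward) = curveAt s (k, .wForward) := by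
  rcases hv : vState s k <;> rcases hw : wState s k
  · exact absurd ⟨hv, hw⟩ h
  · obtain ⟨a, b⟩ := curveAt_of_vState_white s hv
    obtain ⟨c, d⟩ := curveAt_of_wState_crossing s hw
    exact ⟨c, a.trans (c.symm.trans b), d⟩
  · obtain ⟨a, b⟩ := curveAt_of_vState_crossing s hv
    obtain ⟨c, d⟩ := curveAt_of_wState_white s hw
    exact ⟨a, b, c.trans (a.symm.trans d)⟩
  · obtain ⟨a, b⟩ := curveAt_of_vState_crossing s hv
    exact ⟨a, b, (curveAt_of_wState_crossing s hw).2⟩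

/-- If both edges of some parallel pair are smoothed, every curve passes through one of the `p`
north-east corners. -/
theorem numCurves_le_of_white_pair {k₀ : ZMod p} (hv : vState s k₀ = .white)
    (hw : wState s k₀ = .white) : (toroidalGraph p 1).numCurves s ≤ p := by
  -- Induction goes round the cycle, starting just after the white pair. A white pair joins both
  -- outer corners at its far end to the north-east corner at its near end; any other pair passes
  -- the two outer strands on, exchanging their sides.
  have houter : ∀ n : ℕ,
      (∃ j, curveAt s (j, .vForward) = curveAt s (k₀ + 1 + n, .wForward)) ∧
        ∃ j, curveAt s (j, .vForward) = curveAt s (k₀ + 1 + n, .wBackward) := by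
    intro n
    induction n with
    | zero =>
      rw [Nat.cast_zero, add_zero]
      exact ⟨⟨k₀, (curveAt_of_vState_white s hv).1.symm⟩,
        k₀, (curveAt_of_wState_white s hw).1.symm⟩
    | succ n ih =>
      obtain ⟨⟨i, hi⟩, j, hj⟩ := ih
      rw [Nat.cast_succ, ← add_assoc]
      by_cases h : vState s (k₀ + 1 + n) = .white ∧ wState s (k₀ + 1 + n) = .white
      · exact ⟨⟨_, (curveAt_of_vState_white s h.1).1.symm⟩,
          _, (curveAt_of_wState_white s h.2).1.symm⟩
      · obtain ⟨-, b, c⟩ := curveAt_of_exists_crossing s h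
        exact ⟨⟨j, hj.trans b.symm⟩, i, hi.trans c.symm⟩
  have houter' : ∀ k, (∃ j, curveAt s (j, .vForward) = curveAt s (k, .wForward)) ∧
      ∃ j, curveAt s (j, .vForward) = curveAt s (k, .wBackward) := by
    intro k
    have h := houter (k - (k₀ + 1)).val
    rwa [ZMod.natCast_zmod_val, add_sub_cancel] at h
  have hsurj : Function.Surjective fun j => curveAt s (j, .vForward) := by
    intro c
    obtain ⟨⟨k, h⟩, rfl⟩ := curveAt_surjective s c
    cases h
    · exact ⟨k, rfl⟩
    · exact (houter' k).1
    -- A south-west corner is governed by the pair that ends at its vertex, and pairs are indexed by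
    -- their initial vertex.
    · obtain ⟨k, rfl⟩ : ∃ l, k = l + 1 := ⟨k - 1, by ring⟩
      by_cases h : vState s k = .white ∧ wState s k = .white
      · obtain ⟨j, hj⟩ := (houter' k).2
        exact ⟨j, hj.trans (curveAt_of_vState_white s h.1).2.symm⟩
      · exact ⟨k, (curveAt_of_exists_crossing s h).1.symm⟩
    · exact (houter' k).2
  simpa [EmbeddedGraph.numCurves] using Nat.card_le_card_of_surjective _ hsurj

/-- If no parallel pair is smoothed but the state is not all crossings, then the curves arise from
those of the state of all crossings by identifying some of them. -/
theorem numCurves_lt_of_no_white_pair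
    (hs : ∀ k, ¬ (vState s k = .white ∧ wState s k = .white)) (hne : s ≠ crossingState p 1) :
    (toroidalGraph p 1).numCurves s < (toroidalGraph p 1).numCurves (crossingState p 1) := by
  have hpair := fun k => curveAt_of_exists_crossing s (hs k)
  -- The identifications in `hpair` are exactly those generated by the all-crossing state, so its
  -- curves map onto those of `s`.
  obtain ⟨F, hF⟩ := exists_curve_lift (crossingState p 1) (curveAt s)
    (by
      rintro ⟨k, h⟩
      have h1 := hpair k
      have h2 := hpair (k - 1)
      rw [sub_add_cancel] at h2
      cases h <;> simp only [vStep, vState, crossingState]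
      exacts [h1.1, h2.2.1.symm, h2.1.symm, h1.2.1])
    (by
      rintro ⟨k, h⟩
      have h1 := hpair k
      have h2 := hpair (k - 1)
      rw [sub_add_cancel] at h2
      cases h <;> simp only [wStep, wState, crossingState]
      exacts [h1.1, h1.2.2, h2.1.symm, h2.2.2.symm])
  have hsurj : Function.Surjective F := by
    intro c
    obtain ⟨x, rfl⟩ := curveAt_surjective s c
    exact ⟨_, hF x⟩
  -- A single white edge joins a digon corner to an outer corner, and `s` has such an edge because
  -- it is not all crossings.
  have hmerge : ∃ k x, curveAt s (k, .vForward) = curveAt s x ∧ digonOf x = none := by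
    by_contra! hno
    refine hne (state_ext (fun k => ?_) fun k => ?_)
    · change vState s k = .crossing
      rcases hv : vState s k
      · exact absurd rfl (hno k (k + 1, .wForward) (curveAt_of_vState_white s hv).1.symm)
      · rfl
    · change wState s k = .crossing
      rcases hw : wState s k
      · exact absurd rfl (hno k (k + 1, .wBackward) (curveAt_of_wState_white s hw).1.symm)
      · rfl
  -- Equal cardinalities would make `F` injective, so the joined corners would already share a curve
  -- in the all-crossing state, where `digonOf` separates them.
  refine lt_of_le_of_ne (Nat.card_le_card_of_surjective F hsurj) fun heq => ?_
  have hbij := (Nat.bijective_iff_surjective_and_card F).2 ⟨hsurj, heq.symm⟩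
  obtain ⟨k, x, hkx, hx⟩ := hmerge
  rw [← hF, ← hF] at hkx
  obtain ⟨H, hH⟩ := exists_digon_lift (p := p)
  have h := congrArg H (hbij.injective hkx)
  rw [hH, hH, hx] at h
  cases h

end Parallel

/-! ### The parallel case concluded, and the theorem. -/

theorem penrosePolynomial_toroidalGraph_one (p : ℕ) [NeZero p] :
    (toroidalGraph p 1).penrosePolynomial.Monic ∧
      p < (toroidalGraph p 1).penrosePolynomial.natDegree := by
  obtain ⟨hm, hd⟩ := (toroidalGraph p 1).penrosePolynomial_of_unique_max (crossingState p 1)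
    (even_numCrossings_crossingState 1) fun s hs => by
      by_cases h : ∃ k, vState s k = .white ∧ wState s k = .white
      · obtain ⟨k, hv, hw⟩ := h
        exact (numCurves_le_of_white_pair s hv hw).trans_lt lt_numCurves_crossingState
      · exact numCurves_lt_of_no_white_pair s (not_exists.1 h) hs
  exact ⟨hm, hd ▸ lt_numCurves_crossingState⟩

end

theorem mainTheorem5 (p q : ℕ) (hq : 1 ≤ q) (hqp : q < p) (hpq : Nat.Coprime p q) :
    (heegaardGraph p q (Nat.zero_lt_of_lt hqp) hpq).penrosePolynomial.Monic ∧
      (p < (heegaardGraph p q (Nat.zero_lt_of_lt hqp) hpq).penrosePolynomial.natDegree ↔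
        q = 1 ∨ q + 1 = p) := by
  have : NeZero p := ⟨by omega⟩
  rw [penrosePolynomial_heegaardGraph]
  by_cases h : q = 1 ∨ q + 1 = p
  · have key : (toroidalGraph p (q : ZMod p)).penrosePolynomial =
        (toroidalGraph p 1).penrosePolynomial := by
      rcases h with rfl | h
      · rw [Nat.cast_one]
      · rw [penrosePolynomial_toroidalGraph_neg]
        have : ((q + 1 : ℕ) : ZMod p) = 0 := by rw [h, ZMod.natCast_self]
        rw [Nat.cast_succ] at this
        rw [neg_eq_of_add_eq_zero_right this]
    rw [key]
    have := penrosePolynomial_toroidalGraph_one p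
    exact ⟨this.1, iff_of_true this.2 h⟩
  · push Not at h
    -- Here `1 < q < p - 1`, so `p ≥ 4`, and `p = 4` would force `q = 2`, which is not coprime to
    -- `4`. This secures `4 ≠ 0` in `ZMod p`.
    have hp5 : 4 < p := by
      by_contra! hp
      have : p = 4 := by omega
      subst this
      have : q = 2 := by omega
      subst this
      revert hpq
      decide
    have hnd : ∀ n : ℕ, 0 < n → n < p → (n : ZMod p) ≠ 0 := fun n h0 hn h => by
      rw [ZMod.natCast_eq_zero_iff] at h
      exact absurd (Nat.le_of_dvd h0 h) (by omega)
    obtain ⟨hm, hd⟩ := penrosePolynomial_toroidalGraph_of_ne (p := p) (q := (q : ZMod p))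
      (by exact_mod_cast hnd 2 (by omega) (by omega))
      (by exact_mod_cast hnd 4 (by omega) hp5)
      (by
        intro h2
        have : ((2 * q : ℕ) : ZMod p) = 0 := by exact_mod_cast h2
        rw [ZMod.natCast_eq_zero_iff] at this
        -- Coprimality turns `p ∣ 2 * q` into `p ∣ 2`.
        exact absurd (Nat.le_of_dvd two_pos (hpq.dvd_of_dvd_mul_right this)) (by omega))
      (by
        intro h1
        refine hnd (q - 1) (by omega) (by omega) ?_
        rw [Nat.cast_sub hq, h1, Nat.cast_one, sub_self])
      (by
        intro h1
        refine hnd (q + 1) (by omega) (by omega) ?_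
        rw [Nat.cast_succ, h1, neg_add_cancel])
    refine ⟨hm, iff_of_false (by omega) (by omega)⟩
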